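/- Let $K$ be a number field with $s>0$ real embeddings and $2t>0$ non-real complex embeddings. Let $\sigma_1,\dots,\sigma_s$ be the real embeddings and choose $\sigma_{s+1},\dots,\sigma_{s+t}$, one from each pair of complex conjugate embeddings. Let $U\subset\mathcal O_K^{*}$ be a group of units that are positive under all real embeddings, and assume that $U$ is admissible, i.e. that $\{(\log\sigma_1(u),\dots,\log\sigma_s(u)) : u\in U\}$ is a full lattice (a discrete subgroup spanning $\mathbb R^s$). Let $\mathbb H\subset\mathbb C$ be the upper half-plane. The group $\mathcal O_K\rtimes U$ acts freely and properly discontinuously on $\mathbb H^s\times\mathbb C^t$ by $(a,u)\cdot(z_i)_{i}=(\sigma_i(u)z_i+\sigma_i(a))_{i}$, and the quotient complex manifold $X(K,U)=(\mathbb H^s\times\mathbb C^t)/(\mathcal O_K\rtimes U)$ is called an Oeljeklaus–Toma manifold. On a complex manifold $(M,J)$, a smooth two-form $\omega$ is called an LCK (locally conformally Kähler) form if it is the fundamental form $\omega(\cdot,\cdot)=g(J\cdot,\cdot)$ of a Hermitian metric $g$ and $d\omega=\theta'\wedge\omega$ for some closed one-form $\theta'$. For a closed one-form $\theta$, a form is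 called $d_\theta$-exact if it equals $d_\theta\eta:=d\eta-\theta\wedge\eta$ for some smooth form $\eta$. All forms are smooth and real. **Proposition.** Let $X=X(K,U)$ be an Oeljeklaus–Toma manifold and let $\theta$ be any closed one-form on $X$. Then there is no LCK form on $X$ that is $d_\theta$-exact. -/

import Mathlib

open scoped Manifold ContDiff Topology

noncomputable section

/-! ### Differential forms on manifolds modelled on a normed space -/

section Forms

variable (V : Type*) [NormedAddCommGroup V] [NormedSpace ℝ V]
  (M : Type*) [TopologicalSpace M] [ChartedSpace V M]

/-- A (not necessarily smooth) real differential form of degree `k` on a manifold `M` modelled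
on `V`. -/
abbrev DForm (k : ℕ) : Type _ :=
  ∀ x : M, (TangentSpace 𝓘(ℝ, V) x) [⋀^Fin k]→L[ℝ] ℝ

variable {V M} {k : ℕ}

namespace DForm

/-- The expression of a form in the preferred chart at `x₀`, that is, its pull-back under the
inverse of that chart. It is meaningful on the target of the chart. -/
def inChart (α : DForm V M k) (x₀ : M) : V → V [⋀^Fin k]→L[ℝ] ℝ := fun y =>
  (α ((chartAt V x₀).symm y)).compContinuousLinearMap
    (mfderiv 𝓘(ℝ, V) 𝓘(ℝ, V) (chartAt V x₀).symm y)

/-- A form is smooth if all its expressions in charts are. -/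
def IsSmooth (α : DForm V M k) : Prop :=
  ∀ x₀ : M, ContDiffOn ℝ ∞ (α.inChart x₀) (chartAt V x₀).target

/-- The exterior derivative: at `x`, pull back to `M` the exterior derivative of the expression
of the form in the preferred chart at `x`. -/
def d (α : DForm V M k) : DForm V M (k + 1) := fun x =>
  (extDeriv (α.inChart x) (chartAt V x x)).compContinuousLinearMap
    (mfderiv 𝓘(ℝ, V) 𝓘(ℝ, V) (chartAt V x) x)

/-- The wedge product `θ ∧ α` of a one-form and a `k`-form:
`(θ ∧ α)(v₀, …, v_k) = ∑ i, (-1)^i θ(v_i) α(v₀, …, v̂_i, …, v_k)`. -/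
def wedge (θ : DForm V M 1) (α : DForm V M k) : DForm V M (k + 1) := fun x =>
  ContinuousAlternatingMap.alternatizeUncurryFin (E := V)
    (((ContinuousAlternatingMap.ofSubsingleton ℝ V ℝ (0 : Fin 1)).symm (θ x)).smulRight (α x))

/-- The twisted (Morse–Novikov, Lichnerowicz) differential `d_θ = d - θ ∧ ·`. -/
def dTwisted (θ : DForm V M 1) (α : DForm V M k) : DForm V M (k + 1) :=
  α.d - θ.wedge α

/-- Smooth closed forms. -/
def IsClosedForm (α : DForm V M k) : Prop := α.IsSmooth ∧ α.d = 0

/-- `α = d_θ η` for some smooth form `η`. -/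
def IsTwistedExact (θ : DForm V M 1) (α : DForm V M (k + 1)) : Prop :=
  ∃ η : DForm V M k, η.IsSmooth ∧ α = dTwisted θ η

end DForm

end Forms

/-! ### Hermitian metrics and LCK forms on complex manifolds -/

section LCK

variable {V : Type*} [NormedAddCommGroup V] [NormedSpace ℝ V] [NormedSpace ℂ V]
  {M : Type*} [TopologicalSpace M] [ChartedSpace V M]

/-- The complex structure of a complex manifold: multiplication by `i` on each tangent space,
which is identified with the model space `V` by a holomorphic chart. -/
def tangentJ (x : M) (v : TangentSpace 𝓘(ℝ, V) x) : TangentSpace 𝓘(ℝ, V) x :=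
  (Complex.I • (show V from v) : V)

variable [IsManifold 𝓘(ℝ, V) ∞ M]

/-- The type of smooth Riemannian metrics on `M`. -/
abbrev RiemMetric (V : Type*) [NormedAddCommGroup V] [NormedSpace ℝ V]
    (M : Type*) [TopologicalSpace M] [ChartedSpace V M] [IsManifold 𝓘(ℝ, V) ∞ M] : Type _ :=
  Bundle.ContMDiffRiemannianMetric 𝓘(ℝ, V) ∞ V (fun x : M => TangentSpace 𝓘(ℝ, V) x)

/-- A Riemannian metric is Hermitian if it is `J`-invariant. -/
def RiemMetric.IsHermitian (g : RiemMetric V M) : Prop :=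
  ∀ (x : M) (v w : TangentSpace 𝓘(ℝ, V) x),
    g.inner x (tangentJ x v) (tangentJ x w) = g.inner x v w

/-- `Ω` is the fundamental two-form of `g`: `Ω(v, w) = g(J v, w)`; for a Hermitian metric this
means `g(v, w) = Ω(v, J w)`. -/
def RiemMetric.IsFundamentalForm (g : RiemMetric V M) (Ω : DForm V M 2) : Prop :=
  ∀ (x : M) (v w : TangentSpace 𝓘(ℝ, V) x), Ω x ![v, w] = g.inner x (tangentJ x v) w

/-- A Hermitian metric with fundamental form `Ω` is locally conformally Kähler if
`dΩ = θ ∧ Ω` for some closed one-form `θ`; the form `Ω` is then called an LCK form. -/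
def DForm.IsLCK (Ω : DForm V M 2) : Prop :=
  Ω.IsSmooth ∧
  (∃ g : RiemMetric V M, g.IsHermitian ∧ g.IsFundamentalForm Ω) ∧
  ∃ θ : DForm V M 1, θ.IsClosedForm ∧ Ω.d = θ.wedge Ω

end LCK

/-! ### Oeljeklaus–Toma manifolds -/

open NumberField

/-- The data that define an Oeljeklaus–Toma manifold: a number field `K` with `s > 0` real and
`2t > 0` complex embeddings, one embedding out of each pair of conjugate embeddings, and an
admissible group `U` of totally positive units, that is, one whose logarithmic image in `ℝ ^ s`
is a full lattice. -/
structure OTData (K : Type*) [Field K] [NumberField K] where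
  /-- the embedding chosen for each infinite place -/
  σ : InfinitePlace K → K →+* ℂ
  mk_σ : ∀ w, InfinitePlace.mk (σ w) = w
  real_pos : 0 < InfinitePlace.nrRealPlaces K
  complex_pos : 0 < InfinitePlace.nrComplexPlaces K
  /-- the group of units -/
  U : Subgroup (𝓞 K)ˣ
  totally_positive : ∀ u ∈ U, ∀ w : InfinitePlace K, w.IsReal → 0 < (σ w (u : K)).re
  discrete : DiscreteTopology
    ((fun (u : (𝓞 K)ˣ) (w : {w : InfinitePlace K // w.IsReal}) =>
      Real.log (σ w.1 (u : K)).re) '' (U : Set (𝓞 K)ˣ))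
  span_eq_top : Submodule.span ℝ
    ((fun (u : (𝓞 K)ˣ) (w : {w : InfinitePlace K // w.IsReal}) =>
      Real.log (σ w.1 (u : K)).re) '' (U : Set (𝓞 K)ˣ)) = ⊤

namespace OTData

variable {K : Type*} [Field K] [NumberField K] (D : OTData K)

/-- The open subset `ℍ ^ s × ℂ ^ t` of `ℂ ^ (s + t)`, with coordinates indexed by the infinite
places: the coordinates at the real places lie in the upper half-plane. -/
def domain (_D : OTData K) : TopologicalSpace.Opens (InfinitePlace K → ℂ) where
  carrier := {z | ∀ w : InfinitePlace K, w.IsReal → 0 < (z w).im}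
  is_open' := by
    have : {z : InfinitePlace K → ℂ | ∀ w : InfinitePlace K, w.IsReal → 0 < (z w).im} =
        ⋂ w : InfinitePlace K, ⋂ _ : w.IsReal, {z | 0 < (z w).im} := by
      ext; simp
    rw [this]
    exact isOpen_iInter_of_finite fun w => isOpen_iInter_of_finite fun _ =>
      isOpen_lt continuous_const (Complex.continuous_im.comp (continuous_apply w))

/-- The affine map `z_w ↦ σ_w(u) z_w + σ_w(a)`. -/
def affine (u : (𝓞 K)ˣ) (a : 𝓞 K) (z : InfinitePlace K → ℂ) : InfinitePlace K → ℂ :=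
  fun w => D.σ w (u : K) * z w + D.σ w (a : K)

/-- Two points of `ℍ ^ s × ℂ ^ t` are equivalent if they lie in the same orbit of
`𝓞 K ⋊ U`, where `(a, u)` acts by `z_w ↦ σ_w(u) z_w + σ_w(a)`. -/
def orbitSetoid : Setoid D.domain where
  r z z' := ∃ u ∈ D.U, ∃ a : 𝓞 K, (z' : InfinitePlace K → ℂ) = D.affine u a z
  iseqv := by
    refine ⟨fun z => ⟨1, D.U.one_mem, 0, ?_⟩, ?_, ?_⟩
    · funext w; simp [affine]
    · rintro z z' ⟨u, hu, a, h⟩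
      refine ⟨u⁻¹, D.U.inv_mem hu, -((u⁻¹ : (𝓞 K)ˣ) : 𝓞 K) * a, ?_⟩
      funext w
      have h1 : D.σ w ((u⁻¹ : (𝓞 K)ˣ) : K) * D.σ w (u : K) = 1 := by
        rw [← map_mul]; norm_cast; simp
      simp only [h, affine]
      push_cast
      rw [map_mul, map_neg]
      linear_combination (-(z : InfinitePlace K → ℂ) w) * h1
    · rintro z z' z'' ⟨u, hu, a, h⟩ ⟨v, hv, b, h'⟩
      refine ⟨v * u, D.U.mul_mem hv hu, v * a + b, ?_⟩
      funext w
      simp only [h', h, affine]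
      push_cast
      simp only [map_mul, map_add]
      ring

/-- The Oeljeklaus–Toma manifold `X(K, U) = (ℍ ^ s × ℂ ^ t) / (𝓞 K ⋊ U)`, with the quotient
topology. -/
def Manifold : Type _ := Quotient D.orbitSetoid

instance : TopologicalSpace D.Manifold :=
  inferInstanceAs (TopologicalSpace (Quotient D.orbitSetoid))

/-- The quotient map. -/
def proj : D.domain → D.Manifold := Quotient.mk D.orbitSetoid

lemma proj_eq_iff {z z' : D.domain} : D.proj z = D.proj z' ↔
    ∃ u ∈ D.U, ∃ a : 𝓞 K, (z' : InfinitePlace K → ℂ) = D.affine u a z :=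
  Quotient.eq (r := D.orbitSetoid)

lemma σ_im {w : InfinitePlace K} (hw : w.IsReal) (x : K) : (D.σ w x).im = 0 := by
  have h : ComplexEmbedding.IsReal (D.σ w) := by
    rw [← InfinitePlace.isReal_mk_iff, D.mk_σ]; exact hw
  have := RingHom.congr_fun h x
  rw [ComplexEmbedding.conjugate_coe_eq] at this
  exact Complex.conj_eq_iff_im.mp this

lemma affine_im (u : (𝓞 K)ˣ) (a : 𝓞 K) (z : InfinitePlace K → ℂ) {w : InfinitePlace K}
    (hw : w.IsReal) : (D.affine u a z w).im = (D.σ w (u : K)).re * (z w).im := by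
  simp [affine, D.σ_im hw]

lemma affine_mem {u : (𝓞 K)ˣ} (hu : u ∈ D.U) (a : 𝓞 K) {z : InfinitePlace K → ℂ}
    (hz : z ∈ D.domain) : D.affine u a z ∈ D.domain := fun w hw => by
  rw [D.affine_im u a z hw]
  exact mul_pos (D.totally_positive u hu w hw) (hz w hw)

lemma affine_contDiff {𝕜 : Type*} [NontriviallyNormedField 𝕜] [NormedAlgebra 𝕜 ℂ]
    (n : WithTop ℕ∞) (u : (𝓞 K)ˣ) (a : 𝓞 K) : ContDiff 𝕜 n (D.affine u a) := by
  unfold affine; fun_prop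

lemma continuous_affine (u : (𝓞 K)ˣ) (a : 𝓞 K) : Continuous (D.affine u a) := by
  unfold affine; fun_prop

lemma continuous_proj : Continuous D.proj := continuous_quot_mk

lemma isOpenMap_proj : IsOpenMap D.proj := by
  intro S hS
  refine (isOpen_coinduced (f := D.proj)).mpr ?_
  have : D.proj ⁻¹' (D.proj '' S) = ⋃ u : D.U, ⋃ a : 𝓞 K,
      (fun z : D.domain => (⟨D.affine u.1 a z, D.affine_mem u.2 a z.2⟩ : D.domain)) ⁻¹' S := by
    ext z
    simp only [Set.mem_preimage, Set.mem_image, Set.mem_iUnion]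
    constructor
    · rintro ⟨y, hy, h⟩
      obtain ⟨u, hu, a, h'⟩ := D.proj_eq_iff.mp h.symm
      refine ⟨⟨u, hu⟩, a, ?_⟩
      convert hy
      exact h'.symm
    · rintro ⟨u, a, h⟩
      exact ⟨_, h, (D.proj_eq_iff.mpr ⟨u.1, u.2, a, rfl⟩).symm⟩
  rw [this]
  exact isOpen_iUnion fun u => isOpen_iUnion fun a => hS.preimage
    (((D.continuous_affine u.1 a).comp continuous_subtype_val).subtype_mk _)

lemma norm_σ (w : InfinitePlace K) (x : K) : ‖D.σ w x‖ = w x := by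
  conv_rhs => rw [← D.mk_σ w]
  rfl

/-- The action of `𝓞 K ⋊ U` is free and properly discontinuous, in the form: every point has a
neighbourhood on which the quotient map is injective. -/
lemma exists_injOn (z : D.domain) : ∃ N ∈ 𝓝 z, Set.InjOn D.proj N := by
  classical
  obtain ⟨w₀, hw₀⟩ : ∃ w : InfinitePlace K, w.IsReal := by
    have := D.real_pos
    rw [InfinitePlace.nrRealPlaces, Fintype.card_pos_iff] at this
    exact ⟨this.some.1, this.some.2⟩
  set L : (𝓞 K)ˣ → {w : InfinitePlace K // w.IsReal} → ℝ :=
    fun u w => Real.log (D.σ w.1 (u : K)).re with hL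
  have h0 : (0 : {w : InfinitePlace K // w.IsReal} → ℝ) ∈ L '' (D.U : Set (𝓞 K)ˣ) :=
    ⟨1, D.U.one_mem, by funext w; simp [hL]⟩
  obtain ⟨ε, hε, hball⟩ : ∃ ε > 0, ∀ y ∈ L '' (D.U : Set (𝓞 K)ˣ), dist y 0 < ε → y = 0 := by
    have := D.discrete
    have h := Metric.isOpen_iff.mp
      (isOpen_discrete ({⟨0, h0⟩} : Set (L '' (D.U : Set (𝓞 K)ˣ)))) ⟨0, h0⟩ rfl
    obtain ⟨ε, hε, h⟩ := h
    refine ⟨ε, hε, fun y hy hd => ?_⟩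
    have : (⟨y, hy⟩ : L '' (D.U : Set (𝓞 K)ˣ)) ∈
        ({⟨0, h0⟩} : Set (L '' (D.U : Set (𝓞 K)ˣ))) := h hd
    exact congrArg Subtype.val this
  let ly : D.domain → {w : InfinitePlace K // w.IsReal} → ℝ :=
    fun x w => Real.log ((x : InfinitePlace K → ℂ) w.1).im
  have hly : Continuous ly := by
    refine continuous_pi fun w => Continuous.log ?_ fun x => (x.2 w.1 w.2).ne'
    exact Complex.continuous_im.comp ((continuous_apply w.1).comp continuous_subtype_val)
  refine ⟨ly ⁻¹' Metric.ball (ly z) (ε / 2) ∩ Metric.ball z (1 / 2),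
    Filter.inter_mem (hly.continuousAt.preimage_mem_nhds (Metric.ball_mem_nhds _ (by positivity)))
      (Metric.ball_mem_nhds _ (by norm_num)), ?_⟩
  rintro x ⟨hx, hx'⟩ y ⟨hy, hy'⟩ hxy
  obtain ⟨u, hu, a, h⟩ := D.proj_eq_iff.mp hxy
  have hLu : L u = ly y - ly x := by
    funext w
    have h1 := D.totally_positive u hu w.1 w.2
    have h2 := x.2 w.1 w.2
    simp only [hL, ly, h, Pi.sub_apply]
    rw [D.affine_im u a x w.2, Real.log_mul h1.ne' h2.ne']
    ring
  have hLu0 : L u = 0 := by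
    refine hball _ ⟨u, hu, rfl⟩ ?_
    rw [hLu, dist_zero_right, ← dist_eq_norm]
    have h1 := Metric.mem_ball.mp hx
    have h2 := Metric.mem_ball.mp hy
    have h3 := dist_triangle_right (ly y) (ly x) (ly z)
    linarith
  have hu1 : D.σ w₀ (u : K) = 1 := by
    have h1 := D.totally_positive u hu w₀ hw₀
    have h2 : Real.log (D.σ w₀ (u : K)).re = 0 := congrFun hLu0 ⟨w₀, hw₀⟩
    have h3 : (D.σ w₀ (u : K)).re = 1 := Real.eq_one_of_pos_of_log_eq_zero h1 h2
    exact Complex.ext (by simpa using h3) (by simpa using D.σ_im hw₀ _)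
  have hu1' : (u : K) = 1 := (D.σ w₀).injective (by rw [hu1, map_one])
  have hsmall : ∀ w : InfinitePlace K, w (a : K) < 1 := by
    intro w
    have h1 : D.σ w (a : K) = (y : InfinitePlace K → ℂ) w - (x : InfinitePlace K → ℂ) w := by
      rw [h]; simp [affine, hu1']
    rw [← D.norm_σ, h1, ← dist_eq_norm]
    have h2 : dist y x < 1 := by
      have h3 := dist_triangle_right y x z
      have h4 := Metric.mem_ball.mp hx'
      have h5 := Metric.mem_ball.mp hy'
      linarith
    exact (dist_le_pi_dist (y : InfinitePlace K → ℂ) x w).trans_lt h2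
  have ha : a = 0 := by
    by_contra hne
    exact absurd (InfinitePlace.one_le_of_lt_one (w := w₀) hne fun w _ => hsmall w)
      (not_le.mpr (hsmall w₀))
  apply Subtype.ext
  rw [h]
  funext w
  simp [affine, hu1', ha]

lemma isLocalHomeomorph_proj : IsLocalHomeomorph D.proj := by
  rw [isLocalHomeomorph_iff_isOpenEmbedding_restrict]
  intro z
  obtain ⟨N, hN, hinj⟩ := D.exists_injOn z
  obtain ⟨N', hN', hopen, hz⟩ := mem_nhds_iff.mp hN
  refine ⟨N', hopen.mem_nhds hz, Topology.IsOpenEmbedding.of_continuous_injective_isOpenMap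
    (D.continuous_proj.comp continuous_subtype_val) ?_ (D.isOpenMap_proj.domRestrict hopen)⟩
  exact Set.injOn_iff_injective.mp (hinj.mono hN')

lemma domain_nonempty : Nonempty D.domain :=
  ⟨⟨fun _ => Complex.I, fun w _ => by simp⟩⟩

/-- The chart of the quotient given by a local inverse of the quotient map. -/
def chartOf (e : OpenPartialHomeomorph D.domain D.Manifold) :
    OpenPartialHomeomorph D.Manifold (InfinitePlace K → ℂ) :=
  e.symm.trans (D.domain.openPartialHomeomorphSubtypeCoe D.domain_nonempty)

/-- The manifold structure of the quotient: the charts are the local inverses of the quotient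
map. -/
instance : ChartedSpace (InfinitePlace K → ℂ) D.Manifold where
  atlas := {c | ∃ e : OpenPartialHomeomorph D.domain D.Manifold, ⇑e = D.proj ∧ c = D.chartOf e}
  chartAt x := D.chartOf (D.isLocalHomeomorph_proj (Quotient.out x)).choose
  mem_chart_source x := by
    have h := (D.isLocalHomeomorph_proj (Quotient.out x)).choose_spec
    have h1 : D.proj (Quotient.out x) = x := Quotient.out_eq x
    have h2 := OpenPartialHomeomorph.map_source _ h.1
    rw [← h.2, h1] at h2
    simpa [chartOf] using h2
  chart_mem_atlas x := ⟨_, (D.isLocalHomeomorph_proj (Quotient.out x)).choose_spec.2.symm, rfl⟩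

lemma chartOf_symm_apply {e : OpenPartialHomeomorph D.domain D.Manifold} (he : ⇑e = D.proj)
    (z : D.domain) : (D.chartOf e).symm (z : InfinitePlace K → ℂ) = D.proj z := by
  have h : (D.domain.openPartialHomeomorphSubtypeCoe D.domain_nonempty).symm
      (z : InfinitePlace K → ℂ) = z :=
    (D.domain.openPartialHomeomorphSubtypeCoe D.domain_nonempty).left_inv (x := z) (by simp)
  simp only [chartOf, OpenPartialHomeomorph.coe_trans_symm, OpenPartialHomeomorph.symm_symm,
    Function.comp_apply, h, he]

lemma mem_domain_of_mem_target {e : OpenPartialHomeomorph D.domain D.Manifold}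
    {z : InfinitePlace K → ℂ} (hz : z ∈ (D.chartOf e).target) : z ∈ D.domain := by
  simp only [chartOf, OpenPartialHomeomorph.trans_target] at hz
  simpa using hz.1

/-- The changes of charts are locally given by the affine maps of the group. -/
lemma chartOf_contDiffOn {𝕜 : Type*} [NontriviallyNormedField 𝕜] [NormedAlgebra 𝕜 ℂ]
    (n : WithTop ℕ∞) {e e' : OpenPartialHomeomorph D.domain D.Manifold}
    (he : ⇑e = D.proj) (he' : ⇑e' = D.proj) :
    ContDiffOn 𝕜 n ((D.chartOf e).symm.trans (D.chartOf e'))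
      ((D.chartOf e).symm.trans (D.chartOf e')).source := by
  intro z hz
  rw [OpenPartialHomeomorph.trans_source] at hz
  have hzt : z ∈ (D.chartOf e).target := hz.1
  have hzs : (D.chartOf e).symm z ∈ (D.chartOf e').source := hz.2
  have hzd := D.mem_domain_of_mem_target hzt
  have hs : (D.chartOf e).symm z = D.proj ⟨z, hzd⟩ := D.chartOf_symm_apply he ⟨z, hzd⟩
  set y := D.chartOf e' ((D.chartOf e).symm z) with hy
  have hyt : y ∈ (D.chartOf e').target := (D.chartOf e').map_source hzs
  have hyd := D.mem_domain_of_mem_target hyt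
  have hyz : D.proj ⟨z, hzd⟩ = D.proj ⟨y, hyd⟩ := by
    rw [← hs, ← D.chartOf_symm_apply he' ⟨y, hyd⟩]
    exact ((D.chartOf e').left_inv hzs).symm
  obtain ⟨u, hu, a, h⟩ := D.proj_eq_iff.mp hyz
  have hev : ∀ᶠ x in 𝓝 z, ((D.chartOf e).symm.trans (D.chartOf e')) x = D.affine u a x := by
    have h1 : ∀ᶠ x in 𝓝 z, D.affine u a x ∈ (D.chartOf e').target := by
      refine (D.continuous_affine u a).continuousAt.eventually
        ((D.chartOf e').open_target.mem_nhds ?_)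
      rw [← show y = D.affine u a z from h]; exact hyt
    filter_upwards [h1, D.domain.isOpen.mem_nhds hzd] with x hx hxd
    have h2 : D.proj ⟨x, hxd⟩ = D.proj ⟨D.affine u a x, D.affine_mem hu a hxd⟩ :=
      D.proj_eq_iff.mpr ⟨u, hu, a, rfl⟩
    rw [OpenPartialHomeomorph.coe_trans, Function.comp_apply,
      D.chartOf_symm_apply he ⟨x, hxd⟩, h2, ← D.chartOf_symm_apply he']
    exact (D.chartOf e').right_inv hx
  exact ((D.affine_contDiff n u a).contDiffAt.congr_of_eventuallyEq hev).contDiffWithinAt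

/-- The quotient is a complex manifold. -/
instance : IsManifold 𝓘(ℂ, InfinitePlace K → ℂ) ω D.Manifold := by
  refine isManifold_of_contDiffOn _ _ _ ?_
  rintro _ _ ⟨e, he, rfl⟩ ⟨e', he', rfl⟩
  simpa using D.chartOf_contDiffOn (𝕜 := ℂ) ω he he'

/-- The quotient is a smooth real manifold. -/
instance : IsManifold 𝓘(ℝ, InfinitePlace K → ℂ) ∞ D.Manifold := by
  refine isManifold_of_contDiffOn _ _ _ ?_
  rintro _ _ ⟨e, he, rfl⟩ ⟨e', he', rfl⟩
  simpa using D.chartOf_contDiffOn (𝕜 := ℝ) ∞ he he'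

end OTData

end

/-!
Suppose that `Ω = d_θ η` on `X(K, U)` and `Ω(v, J v) > 0` for `v ≠ 0`. On the convex set
`ℍ ^ s × ℂ ^ t` the pullback of `θ` has a primitive `f`. Each element of `𝓞 K ⋊ U` changes `f` by a
constant, and for the translations in `𝓞 K` this constant is an additive function of `a ∈ 𝓞 K` that
is invariant under multiplication by `U`. It vanishes because `u - 1` divides a nonzero integer for
every `u ≠ 1`. So `f` is invariant under `𝓞 K`, and `exp (-f) Ω = d (exp (-f) η)` is the
differential of an `𝓞 K`-invariant form.

Since `𝓞 K` is a lattice in `ℝ ^ s × ℂ ^ t`, on the leaf `z₀ + ℝ ^ s × ℂ ^ t` the form `exp (-f) η`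
is bounded, while `exp (-f) Ω` is bounded below by a positive constant in the direction of a complex
line of `ℂ ^ t`. On a square of side `r` in such a line, Stokes' theorem compares an integral of
order `r ^ 2` with one of order `r`, which is absurd for large `r`.
-/

noncomputable section

open NumberField

section Pullback

variable {V : Type*} [NormedAddCommGroup V] [NormedSpace ℝ V]
  {M : Type*} [TopologicalSpace M] [ChartedSpace V M]
  {E : Type*} [NormedAddCommGroup E] [NormedSpace ℝ E] {k : ℕ}

namespace DForm

/-- The pullback `F^* α` of a form on `M` under a map `F` from a normed space, as a form on that
space. As for `mfderiv`, the value is meaningful only at points where `F` is differentiable. -/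
def pullback (α : DForm V M k) (F : E → M) (y : E) : E [⋀^Fin k]→L[ℝ] ℝ :=
  (α (F y)).compContinuousLinearMap (mfderiv 𝓘(ℝ, E) 𝓘(ℝ, V) F y)

lemma pullback_congr (α : DForm V M k) {F G : E → M} {z : E} (h : F =ᶠ[𝓝 z] G) :
    α.pullback F z = α.pullback G z := by
  simp only [pullback, h.mfderiv_eq]
  rw [h.eq_of_nhds]

lemma pullback_comp {E' : Type*} [NormedAddCommGroup E'] [NormedSpace ℝ E'] (α : DForm V M k)
    {F : E → M} {φ : E' → E} {L : E' →L[ℝ] E} {z : E'}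
    (hF : MDifferentiableAt 𝓘(ℝ, E) 𝓘(ℝ, V) F (φ z)) (hφ : HasFDerivAt φ L z) :
    α.pullback (F ∘ φ) z = (α.pullback F (φ z)).compContinuousLinearMap L := by
  have h := (hF.hasMFDerivAt.comp z hφ.hasMFDerivAt).mfderiv
  simp only [pullback, h]
  rfl

variable [IsManifold 𝓘(ℝ, V) ∞ M]

lemma pullback_eventuallyEq (α : DForm V M k) {F : E → M} {z : E}
    (hF : ContMDiffAt 𝓘(ℝ, E) 𝓘(ℝ, V) ∞ F z) :
    α.pullback F =ᶠ[𝓝 z] fun y => (α.inChart (F z) (chartAt V (F z) (F y))).compContinuousLinearMap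
      (fderiv ℝ (chartAt V (F z) ∘ F) y) := by
  set c := chartAt V (F z)
  have hcF : ContDiffAt ℝ ∞ (c ∘ F) z :=
    ((contMDiffAt_of_mem_maximalAtlas (IsManifold.chart_mem_maximalAtlas _)
      (mem_chart_source V _)).comp z hF).contDiffAt
  have hsource : ∀ᶠ y in 𝓝 z, F y ∈ c.source :=
    hF.continuousAt.eventually (chart_source_mem_nhds V _)
  filter_upwards [(hcF.of_le (m := 1) (by simp)).eventually (by simp), hsource,
    hsource.eventually_nhds] with y hcFy hy hnear
  have hsymm : MDifferentiableAt 𝓘(ℝ, V) 𝓘(ℝ, V) c.symm (c (F y)) :=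
    ((contMDiffOn_chart_symm (n := ∞)).contMDiffAt
      (c.open_target.mem_nhds (c.map_source hy))).mdifferentiableAt (by simp)
  have hF_eq : F =ᶠ[𝓝 y] c.symm ∘ (c ∘ F) := by
    filter_upwards [hnear] with x hx using (c.left_inv hx).symm
  rw [α.pullback_congr hF_eq,
    α.pullback_comp (φ := c ∘ F) hsymm (hcFy.differentiableAt (by simp)).hasFDerivAt]
  rfl

lemma pullback_d {α : DForm V M k} (hα : α.IsSmooth) {F : E → M} {z : E}
    (hF : ContMDiffAt 𝓘(ℝ, E) 𝓘(ℝ, V) ∞ F z) :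
    α.d.pullback F z = extDeriv (α.pullback F) z := by
  set c := chartAt V (F z)
  have hc : ContMDiffAt 𝓘(ℝ, V) 𝓘(ℝ, V) ∞ c (F z) :=
    contMDiffAt_of_mem_maximalAtlas (IsManifold.chart_mem_maximalAtlas _) (mem_chart_source V _)
  have hcF : ContDiffAt ℝ ∞ (c ∘ F) z := (hc.comp z hF).contDiffAt
  have hαc : DifferentiableAt ℝ (α.inChart (F z)) (c (F z)) :=
    ((hα (F z)).contDiffAt
      (c.open_target.mem_nhds (mem_chart_target V _))).differentiableAt (by simp)
  have hchain : fderiv ℝ (c ∘ F) z = (mfderiv 𝓘(ℝ, V) 𝓘(ℝ, V) c (F z)).comp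
      (mfderiv 𝓘(ℝ, E) 𝓘(ℝ, V) F z) := by
    rw [← mfderiv_eq_fderiv]
    exact mfderiv_comp z (hc.mdifferentiableAt (by simp)) (hF.mdifferentiableAt (by simp))
  rw [(α.pullback_eventuallyEq hF).extDeriv_eq]
  refine Eq.trans ?_ (extDeriv_pullback (f := c ∘ F) hαc hcF
    (by simpa using ENat.LEInfty.out)).symm
  rw [hchain]
  rfl

end DForm

end Pullback

section OneForms

variable {E E' : Type*} [NormedAddCommGroup E] [NormedSpace ℝ E]
  [NormedAddCommGroup E'] [NormedSpace ℝ E'] {k : ℕ}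

variable (E) in
/-- The identification of alternating forms of degree one with linear functionals that enters
the definition of `DForm.wedge`. -/
def oneFormEquiv : E [⋀^Fin 1]→L[ℝ] ℝ ≃ₗᵢ[ℝ] E →L[ℝ] ℝ :=
  (ContinuousAlternatingMap.ofSubsingletonLIE (0 : Fin 1)).symm

lemma oneFormEquiv_apply (α : E [⋀^Fin 1]→L[ℝ] ℝ) (v : E) : oneFormEquiv E α v = α ![v] :=
  congrArg α (funext fun i => by fin_cases i; rfl : (fun _ : Fin 1 => v) = ![v])

lemma oneFormEquiv_compContinuousLinearMap (α : E [⋀^Fin 1]→L[ℝ] ℝ) (L : E' →L[ℝ] E) :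
    oneFormEquiv E' (α.compContinuousLinearMap L) = (oneFormEquiv E α).comp L :=
  rfl

open ContinuousAlternatingMap

lemma extDeriv_smul_of_hasFDerivAt {g : E → ℝ} {g' : E →L[ℝ] ℝ} {α : E → E [⋀^Fin k]→L[ℝ] ℝ}
    {z : E} (hg : HasFDerivAt g g' z) (hα : DifferentiableAt ℝ α z) :
    extDeriv (fun y => g y • α y) z =
      g z • extDeriv α z + alternatizeUncurryFin (g'.smulRight (α z)) := by
  rw [extDeriv, (hg.fun_smul hα.hasFDerivAt).fderiv, alternatizeUncurryFin_add,
    alternatizeUncurryFin_smul, extDeriv]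

lemma alternatizeUncurryFin_smulRight_compContinuousLinearMap (l : E →L[ℝ] ℝ)
    (α : E [⋀^Fin k]→L[ℝ] ℝ) (L : E' →L[ℝ] E) :
    (alternatizeUncurryFin (l.smulRight α)).compContinuousLinearMap L =
      alternatizeUncurryFin ((l.comp L).smulRight (α.compContinuousLinearMap L)) := by
  ext v
  simp +unfoldPartialApp [alternatizeUncurryFin_apply, Fin.removeNth, Function.comp_def]

variable {V : Type*} [NormedAddCommGroup V] [NormedSpace ℝ V]
  {M : Type*} [TopologicalSpace M] [ChartedSpace V M]

lemma DForm.pullback_wedge (θ : DForm V M 1) (η : DForm V M k) (F : E → M) (z : E) :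
    (θ.wedge η).pullback F z =
      alternatizeUncurryFin ((oneFormEquiv E (θ.pullback F z)).smulRight (η.pullback F z)) :=
  alternatizeUncurryFin_smulRight_compContinuousLinearMap (E := V) (E' := E)
    (oneFormEquiv V (θ (F z))) (η (F z))
    (mfderiv 𝓘(ℝ, E) 𝓘(ℝ, V) F z)

lemma DForm.extDeriv_exp_neg_smul_pullback [IsManifold 𝓘(ℝ, V) ∞ M] {θ : DForm V M 1}
    {η : DForm V M k} (hη : η.IsSmooth) {F : E → M} {f : E → ℝ} {z : E}
    (hF : ContMDiffAt 𝓘(ℝ, E) 𝓘(ℝ, V) ∞ F z)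
    (hηF : DifferentiableAt ℝ (η.pullback F) z)
    (hf : HasFDerivAt f (oneFormEquiv E (θ.pullback F z)) z) :
    extDeriv (fun y => Real.exp (-f y) • η.pullback F y) z =
      Real.exp (-f z) • (DForm.dTwisted θ η).pullback F z := by
  have hdTwisted : (DForm.dTwisted θ η).pullback F z =
      η.d.pullback F z - (θ.wedge η).pullback F z := rfl
  have hexp : HasFDerivAt (fun y => Real.exp (-f y)) _ z := hf.fun_neg.exp
  rw [extDeriv_smul_of_hasFDerivAt hexp hηF, hdTwisted, pullback_d hη hF, pullback_wedge]
  have hsmulRight : (Real.exp (-f z) • -oneFormEquiv E (θ.pullback F z)).smulRight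
      (η.pullback F z) =
      -Real.exp (-f z) • (oneFormEquiv E (θ.pullback F z)).smulRight (η.pullback F z) := by
    ext; simp [mul_assoc]
  rw [hsmulRight, alternatizeUncurryFin_smul]
  module

end OneForms

section Taming

variable {V : Type*} [NormedAddCommGroup V] [NormedSpace ℝ V] [NormedSpace ℂ V]
  {M : Type*} [TopologicalSpace M] [ChartedSpace V M]

/-- A two-form `Ω` tames the complex structure if `Ω(v, J v) > 0` for every nonzero tangent
vector `v`. -/
def DForm.IsTaming (Ω : DForm V M 2) : Prop :=
  ∀ (x : M) (v : TangentSpace 𝓘(ℝ, V) x), v ≠ 0 → 0 < Ω x ![v, tangentJ x v]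

lemma RiemMetric.IsFundamentalForm.isTaming [IsManifold 𝓘(ℝ, V) ∞ M] {g : RiemMetric V M}
    {Ω : DForm V M 2} (hΩ : g.IsFundamentalForm Ω) : Ω.IsTaming := by
  intro x v hv
  rw [hΩ]
  exact g.pos x _ (smul_ne_zero (M := V) Complex.I_ne_zero hv)

end Taming

section Calculus

open MeasureTheory in
lemma exists_divergence_lt_of_bounded {g h : ℝ × ℝ → ℝ} (hg : ContDiff ℝ 1 g)
    (hh : ContDiff ℝ 1 h) {B ε : ℝ} (hgB : ∀ p, |g p| ≤ B) (hhB : ∀ p, |h p| ≤ B) (hε : 0 < ε) :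
    ∃ p, fderiv ℝ g p (1, 0) + fderiv ℝ h p (0, 1) < ε := by
  by_contra! hdiv
  have hB : 0 ≤ B := (abs_nonneg _).trans (hgB 0)
  set R := 4 * B / ε + 1 with hR
  have hR_pos : 0 < R := by positivity
  have hcont : Continuous fun p : ℝ × ℝ => fderiv ℝ g p (1, 0) + fderiv ℝ h p (0, 1) :=
    ((hg.continuous_fderiv one_ne_zero).clm_apply continuous_const).add
      ((hh.continuous_fderiv one_ne_zero).clm_apply continuous_const)
  have hint := hcont.continuousOn.integrableOn_compact (μ := volume)
    (isCompact_Icc (a := ((0, 0) : ℝ × ℝ)) (b := (R, R)))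
  have hvolume : volume.real (Set.Icc ((0, 0) : ℝ × ℝ) (R, R)) = R * R := by
    rw [← Set.Icc_prod_Icc, Measure.volume_eq_prod, measureReal_prod_prod, Real.volume_real_Icc]
    simp [hR_pos.le]
  have hlower : ε * (R * R) ≤ ∫ p in Set.Icc (0, 0) (R, R),
      fderiv ℝ g p (1, 0) + fderiv ℝ h p (0, 1) := by
    rw [← hvolume]
    exact setIntegral_ge_of_const_le_real measurableSet_Icc isCompact_Icc.measure_ne_top
      (fun p _ => hdiv p) hint
  have hstokes := integral_divergence_prod_Icc_of_hasFDerivAt_of_le g h (fderiv ℝ g) (fderiv ℝ h)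
    (0, 0) (R, R) ⟨hR_pos.le, hR_pos.le⟩ hg.continuous.continuousOn hh.continuous.continuousOn
    (fun p _ => (hg.differentiable one_ne_zero p).hasFDerivAt)
    (fun p _ => (hh.differentiable one_ne_zero p).hasFDerivAt) hint
  have hside {φ : ℝ → ℝ} (hφ : ∀ t, |φ t| ≤ B) : |∫ t in 0..R, φ t| ≤ B * R := by
    simpa [abs_of_pos hR_pos] using
      intervalIntegral.norm_integral_le_of_norm_le_const (a := 0) (b := R) (f := φ) fun t _ => hφ t
  have hupper : ε * (R * R) ≤ 4 * B * R := by
    have htop := abs_le.mp (hside fun t => hhB (t, R))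
    have hbottom := abs_le.mp (hside fun t => hhB (t, 0))
    have hright := abs_le.mp (hside fun t => hgB (R, t))
    have hleft := abs_le.mp (hside fun t => hgB (0, t))
    dsimp only at hstokes
    linarith
  have hεR : ε * R = 4 * B + ε := by rw [hR]; field_simp
  nlinarith

variable {E : Type*} [NormedAddCommGroup E] [NormedSpace ℝ E] {s : Set E}

lemma continuousOn_extDeriv {F : Type*} [NormedAddCommGroup F] [NormedSpace ℝ F] {k : ℕ}
    {β : E → E [⋀^Fin k]→L[ℝ] F} (hs : IsOpen s) (hβ : ContDiffOn ℝ 1 β s) :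
    ContinuousOn (extDeriv β) s :=
  (ContinuousAlternatingMap.alternatizeUncurryFinCLM ℝ E F).continuous.comp_continuousOn
    (hβ.continuousOn_fderiv_of_isOpen hs le_rfl)

variable {β : E → E [⋀^Fin 1]→L[ℝ] ℝ}

lemma fderiv_oneFormEquiv_apply {z : E} (hβ : DifferentiableAt ℝ β z) (v w : E) :
    fderiv ℝ (fun y => oneFormEquiv E (β y)) z v w = fderiv ℝ (fun y => β y ![w]) z v := by
  have hleft : fderiv ℝ (fun y => oneFormEquiv E (β y)) z v = oneFormEquiv E (fderiv ℝ β z v) :=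
    DFunLike.congr_fun ((oneFormEquiv E).comp_fderiv (f := β)) v
  have hright : fderiv ℝ (fun y => β y ![w]) z v = fderiv ℝ β z v ![w] := DFunLike.congr_fun
    ((ContinuousAlternatingMap.apply ℝ E ℝ ![w]).hasFDerivAt.comp z hβ.hasFDerivAt).fderiv v
  rw [hleft, hright, oneFormEquiv_apply]

lemma extDeriv_oneForm_apply {z : E} (hβ : DifferentiableAt ℝ β z) (v w : E) :
    extDeriv β z ![v, w] = fderiv ℝ (fun y => β y ![w]) z v - fderiv ℝ (fun y => β y ![v]) z w := by
  have hremove₀ : (0 : Fin 2).removeNth ![v, w] = ![w] := by ext i; fin_cases i; rfl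
  have hremove₁ : (1 : Fin 2).removeNth ![v, w] = ![v] := by ext i; fin_cases i; rfl
  rw [extDeriv_apply hβ, Fin.sum_univ_two, hremove₀, hremove₁]
  simp [sub_eq_add_neg]

lemma exists_extDeriv_lt_of_bounded {α : ℝ × ℝ → (ℝ × ℝ) [⋀^Fin 1]→L[ℝ] ℝ}
    (hα : ContDiff ℝ 1 α) {B ε : ℝ} (hB : ∀ p, ‖α p‖ ≤ B) (hε : 0 < ε) :
    ∃ p, extDeriv α p ![(1, 0), (0, 1)] < ε := by
  have hcomponent (x : ℝ × ℝ) : ContDiff ℝ 1 fun p => α p ![x] :=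
    (ContinuousAlternatingMap.apply ℝ (ℝ × ℝ) ℝ ![x]).contDiff.comp hα
  have hbound {x : ℝ × ℝ} (hx : ‖x‖ ≤ 1) (p : ℝ × ℝ) : |α p ![x]| ≤ B := by
    have := (α p).le_opNorm ![x]
    simp only [Fin.prod_univ_one, Matrix.cons_val_zero, Real.norm_eq_abs] at this
    nlinarith [norm_nonneg (α p), hB p]
  obtain ⟨p, hp⟩ := exists_divergence_lt_of_bounded (hcomponent (0, 1)) (hcomponent (1, 0)).neg
    (hbound (by simp)) (fun p => by simpa using hbound (x := (1, 0)) (by simp) p) hε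
  refine ⟨p, ?_⟩
  rw [extDeriv_oneForm_apply (hα.differentiable one_ne_zero p)]
  simpa [sub_eq_add_neg] using hp

lemma exists_extDeriv_lt_of_bounded_on_plane (hs : IsOpen s) (hβ : ContDiffOn ℝ 1 β s)
    {z₀ v w : E} (hplane : ∀ p : ℝ × ℝ, z₀ + (p.1 • v + p.2 • w) ∈ s) {B : ℝ}
    (hB : ∀ p : ℝ × ℝ, ‖β (z₀ + (p.1 • v + p.2 • w))‖ ≤ B) {ε : ℝ} (hε : 0 < ε) :
    ∃ p : ℝ × ℝ, extDeriv β (z₀ + (p.1 • v + p.2 • w)) ![v, w] < ε := by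
  set L : ℝ × ℝ →L[ℝ] E :=
    (ContinuousLinearMap.fst ℝ ℝ ℝ).smulRight v + (ContinuousLinearMap.snd ℝ ℝ ℝ).smulRight w
  set ι : ℝ × ℝ → E := fun p => z₀ + L p
  have hι : ContDiff ℝ 2 ι := by fun_prop
  have hfderiv : fderiv ℝ ι = fun _ => L :=
    funext fun p => (L.hasFDerivAt.const_add z₀).fderiv
  have hpullback_contDiff : ContDiff ℝ 1 fun p => (β (ι p)).compContinuousLinearMap L := by
    refine (ContinuousAlternatingMap.compContinuousLinearMapCLM
      (F := ℝ) (ι := Fin 1) L).contDiff.comp ?_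
    rw [← contDiffOn_univ]
    exact hβ.comp (hι.of_le one_le_two).contDiffOn fun p _ => hplane p
  obtain ⟨p, hp⟩ := exists_extDeriv_lt_of_bounded hpullback_contDiff
    (fun p => ((β (ι p)).norm_compContinuousLinearMap_le L).trans
      (mul_le_mul_of_nonneg_right (hB p) (by positivity))) hε
  refine ⟨p, lt_of_eq_of_lt ?_ hp⟩
  have hβ_diff : DifferentiableAt ℝ β (ι p) :=
    (hβ.contDiffAt (hs.mem_nhds (hplane p))).differentiableAt one_ne_zero
  have hpullback := extDeriv_pullback (r := 2) hβ_diff hι.contDiffAt (by simp)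
  simp only [hfderiv] at hpullback
  have hL : L ∘ ![(1, 0), (0, 1)] = ![v, w] := by
    ext i; fin_cases i <;> simp [L]
  rw [hpullback, ContinuousAlternatingMap.compContinuousLinearMap_apply, hL]
  rfl

lemma exists_primitive_of_extDeriv_eq_zero (hs : Convex ℝ s) (hs_open : IsOpen s)
    (hβ : DifferentiableOn ℝ β s) (hclosed : ∀ z ∈ s, extDeriv β z = 0) :
    ∃ f : E → ℝ, ∀ z ∈ s, HasFDerivAt f (oneFormEquiv E (β z)) z := by
  refine hs.exists_forall_hasFDerivAt_of_fderiv_symmetric hs_open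
    ((oneFormEquiv E).differentiable.comp_differentiableOn hβ) fun z hz v w => ?_
  have hβz := hβ.differentiableAt (hs_open.mem_nhds hz)
  have hsymm : extDeriv β z ![v, w] = 0 := by rw [hclosed z hz]; rfl
  rw [extDeriv_oneForm_apply hβz, sub_eq_zero] at hsymm
  exact (fderiv_oneFormEquiv_apply hβz v w).trans
    (hsymm.trans (fderiv_oneFormEquiv_apply hβz w v).symm)

lemma exists_comp_eq_add_const {f : E → ℝ} {f' : E → E →L[ℝ] ℝ} {φ : E → E} {φ' : E → E →L[ℝ] E}
    (hs : IsOpen s) (hs_conn : IsPreconnected s) (hf : ∀ z ∈ s, HasFDerivAt f (f' z) z)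
    (hφ : ∀ z ∈ s, HasFDerivAt φ (φ' z) z) (hφs : Set.MapsTo φ s s)
    (hinv : ∀ z ∈ s, (f' (φ z)).comp (φ' z) = f' z) :
    ∃ c, ∀ z ∈ s, f (φ z) = f z + c := by
  have hcomp : ∀ z ∈ s, HasFDerivAt (f ∘ φ) (f' z) z := fun z hz =>
    hinv z hz ▸ (hf _ (hφs hz)).comp z (hφ z hz)
  exact hs.exists_eq_add_of_fderiv_eq hs_conn
    (fun z hz => (hcomp z hz).differentiableAt.differentiableWithinAt)
    (fun z hz => (hf z hz).differentiableAt.differentiableWithinAt)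
    fun z hz => (hcomp z hz).fderiv.trans (hf z hz).fderiv.symm

end Calculus

lemma addMonoidHom_eq_zero_of_map_mul_left {R A : Type*} [CommRing R] [IsDomain R]
    [Algebra.IsAlgebraic ℤ R] [AddCommGroup A] [IsAddTorsionFree A] {u : R} (hu : u ≠ 1)
    (c : R →+ A) (hc : ∀ a, c (u * a) = c a) : c = 0 := by
  obtain ⟨n, hn, y, hy⟩ := (Algebra.IsAlgebraic.isAlgebraic (R := ℤ) (u - 1)).exists_nonzero_dvd
    (mem_nonZeroDivisors_of_ne_zero (sub_ne_zero.mpr hu))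
  ext a
  have hmul : c ((u - 1) * (y * a)) = 0 := by rw [sub_mul, one_mul, map_sub, hc, sub_self]
  rw [← mul_assoc, ← hy, algebraMap_int_eq, eq_intCast, ← zsmul_eq_mul, map_zsmul] at hmul
  exact (smul_eq_zero.mp hmul).resolve_left hn

open mixedEmbedding Classical in
lemma exists_norm_sub_mixedEmbedding_le (K : Type*) [Field K] [NumberField K] :
    ∃ R : ℝ, ∀ m : mixedSpace K, ∃ a : 𝓞 K, ‖m - mixedEmbedding K a‖ ≤ R := by
  refine ⟨∑ i, ‖latticeBasis K i‖, fun m => ?_⟩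
  obtain ⟨a, ha⟩ := (mem_span_latticeBasis K).mp (ZSpan.floor (latticeBasis K) m).2
  refine ⟨a, ?_⟩
  rw [show mixedEmbedding K a = ZSpan.floor (latticeBasis K) m from ha, ← ZSpan.fract_apply]
  exact ZSpan.norm_fract_le (K := ℝ) _ m

namespace OTData

section Horizontal

variable (K : Type*) [Field K]

/-- The real subspace `ℝ ^ s × ℂ ^ t` of `ℂ ^ (s + t)`. Its translates foliate
`ℍ ^ s × ℂ ^ t`, and the leaves are preserved by the translations in `𝓞 K`. -/
def horizontal : Submodule ℝ (InfinitePlace K → ℂ) where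
  carrier := {x | ∀ w : InfinitePlace K, w.IsReal → (x w).im = 0}
  zero_mem' := by simp
  add_mem' hx hy w hw := by simp [hx w hw, hy w hw]
  smul_mem' c x hx w hw := by simp [hx w hw]

variable {K}

lemma single_mem_horizontal [DecidableEq (InfinitePlace K)] {w : InfinitePlace K}
    (hw : w.IsComplex) (c : ℂ) : Pi.single w c ∈ horizontal K := fun w' hw' => by
  have hne : w' ≠ w := by
    rintro rfl
    exact InfinitePlace.not_isReal_iff_isComplex.mpr hw hw'
  simp [hne]

end Horizontal

variable {K : Type*} [Field K] [NumberField K] (D : OTData K)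

section Affine

/-- The map `a ↦ (σ_w(a))_w`, by which `𝓞 K` acts on `ℍ ^ s × ℂ ^ t` by translations. -/
def embedding : 𝓞 K →+ (InfinitePlace K → ℂ) where
  toFun a w := D.σ w (a : K)
  map_zero' := by ext; simp
  map_add' a b := by ext; simp

@[simp]
lemma embedding_apply (a : 𝓞 K) (w : InfinitePlace K) : D.embedding a w = D.σ w (a : K) :=
  rfl

/-- The linear map `z ↦ (σ_w(u) z_w)_w`, the linear part of `D.affine u a`. -/
def scale (u : (𝓞 K)ˣ) : (InfinitePlace K → ℂ) →L[ℝ] (InfinitePlace K → ℂ) :=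
  ContinuousLinearMap.pi fun w => D.σ w (u : K) • ContinuousLinearMap.proj (R := ℝ) w

@[simp]
lemma scale_apply (u : (𝓞 K)ˣ) (v : InfinitePlace K → ℂ) (w : InfinitePlace K) :
    D.scale u v w = D.σ w (u : K) * v w := by
  simp [scale]

lemma scale_one : D.scale 1 = ContinuousLinearMap.id ℝ _ := by
  ext; simp

lemma scale_smul (u : (𝓞 K)ˣ) (c : ℂ) (v : InfinitePlace K → ℂ) :
    D.scale u (c • v) = c • D.scale u v := by
  ext; simp [mul_left_comm]

lemma scale_ne_zero (u : (𝓞 K)ˣ) {v : InfinitePlace K → ℂ} (hv : v ≠ 0) : D.scale u v ≠ 0 := by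
  obtain ⟨w, hw⟩ := Function.ne_iff.mp hv
  exact Function.ne_iff.mpr ⟨w, by simpa using hw⟩

lemma scale_embedding (u : (𝓞 K)ˣ) (a : 𝓞 K) :
    D.scale u (D.embedding a) = D.embedding (u * a) := by
  ext; simp

lemma affine_eq (u : (𝓞 K)ˣ) (a : 𝓞 K) (z : InfinitePlace K → ℂ) :
    D.affine u a z = D.scale u z + D.embedding a := by
  ext; simp [affine]

lemma hasFDerivAt_affine (u : (𝓞 K)ˣ) (a : 𝓞 K) (z : InfinitePlace K → ℂ) :
    HasFDerivAt (D.affine u a) (D.scale u) z := by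
  rw [show D.affine u a = fun z => D.scale u z + D.embedding a from funext (D.affine_eq u a)]
  exact (D.scale u).hasFDerivAt.add_const _

lemma add_embedding_mem_domain (a : 𝓞 K) {z : InfinitePlace K → ℂ} (hz : z ∈ D.domain) :
    z + D.embedding a ∈ D.domain := by
  simpa [affine_eq, scale_one] using D.affine_mem D.U.one_mem a hz

lemma convex_domain : Convex ℝ (D.domain : Set (InfinitePlace K → ℂ)) := by
  have : (D.domain : Set (InfinitePlace K → ℂ)) =
      ⋂ w : InfinitePlace K, ⋂ _ : w.IsReal,
        (Complex.imLm ∘ₗ LinearMap.proj w) ⁻¹' Set.Ioi (0 : ℝ) := by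
    ext; simp [domain]
  rw [this]
  exact convex_iInter fun w => convex_iInter fun _ => (convex_Ioi 0).linear_preimage _

end Affine

section Projection

/-- The quotient map `ℍ ^ s × ℂ ^ t → X(K, U)` as a map on the ambient space `ℂ ^ (s + t)`, with
a constant junk value outside `ℍ ^ s × ℂ ^ t`. -/
def projExtend : (InfinitePlace K → ℂ) → D.Manifold :=
  Function.extend Subtype.val D.proj fun _ => D.proj D.domain_nonempty.some

lemma projExtend_coe (z : D.domain) : D.projExtend z = D.proj z :=
  Subtype.val_injective.extend_apply _ _ z

lemma projExtend_affine {u : (𝓞 K)ˣ} (hu : u ∈ D.U) (a : 𝓞 K) {z : InfinitePlace K → ℂ}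
    (hz : z ∈ D.domain) : D.projExtend (D.affine u a z) = D.projExtend z := by
  rw [D.projExtend_coe ⟨z, hz⟩, D.projExtend_coe ⟨_, D.affine_mem hu a hz⟩, eq_comm]
  exact D.proj_eq_iff.mpr ⟨u, hu, a, rfl⟩

lemma chartAt_symm_eqOn (x : D.Manifold) :
    Set.EqOn (chartAt (InfinitePlace K → ℂ) x).symm D.projExtend D.domain := fun z hz =>
  (D.chartOf_symm_apply (D.isLocalHomeomorph_proj (Quotient.out x)).choose_spec.2.symm
    ⟨z, hz⟩).trans (D.projExtend_coe ⟨z, hz⟩).symm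

lemma exists_chartAt_comp_projExtend_eventuallyEq {z : InfinitePlace K → ℂ} (hz : z ∈ D.domain) :
    ∃ u ∈ D.U, ∃ a : 𝓞 K,
      chartAt (InfinitePlace K → ℂ) (D.projExtend z) ∘ D.projExtend =ᶠ[𝓝 z] D.affine u a := by
  set c := chartAt (InfinitePlace K → ℂ) (D.projExtend z)
  have hc_target : c (D.projExtend z) ∈ c.target := mem_chart_target _ _
  have hc_domain : c (D.projExtend z) ∈ D.domain := D.mem_domain_of_mem_target hc_target
  have hproj : D.proj ⟨z, hz⟩ = D.proj ⟨c (D.projExtend z), hc_domain⟩ := by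
    rw [← D.projExtend_coe, ← D.projExtend_coe, ← D.chartAt_symm_eqOn (D.projExtend z) hc_domain]
    exact (c.left_inv (mem_chart_source _ _)).symm
  obtain ⟨u, hu, a, haffine⟩ := D.proj_eq_iff.mp hproj
  have hnear : ∀ᶠ y in 𝓝 z, D.affine u a y ∈ c.target :=
    (D.continuous_affine u a).continuousAt.eventually
      (c.open_target.mem_nhds (haffine ▸ hc_target))
  refine ⟨u, hu, a, ?_⟩
  filter_upwards [hnear, D.domain.isOpen.mem_nhds hz] with y hy hy_domain
  rw [Function.comp_apply, ← D.projExtend_affine hu a hy_domain,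
    ← D.chartAt_symm_eqOn (D.projExtend z) (D.affine_mem hu a hy_domain)]
  exact c.right_inv hy

lemma continuousAt_projExtend {z : InfinitePlace K → ℂ} (hz : z ∈ D.domain) :
    ContinuousAt D.projExtend z := by
  have hcont : ContinuousOn D.projExtend D.domain :=
    continuousOn_iff_continuous_domRestrict.mpr
      (D.continuous_proj.congr fun y => (D.projExtend_coe y).symm)
  exact hcont.continuousAt (D.domain.isOpen.mem_nhds hz)

lemma contMDiffAt_projExtend {z : InfinitePlace K → ℂ} (hz : z ∈ D.domain) :
    ContMDiffAt 𝓘(ℝ, InfinitePlace K → ℂ) 𝓘(ℝ, InfinitePlace K → ℂ) ∞ D.projExtend z := by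
  obtain ⟨u, -, a, hu⟩ := D.exists_chartAt_comp_projExtend_eventuallyEq hz
  rw [contMDiffAt_iff]
  refine ⟨D.continuousAt_projExtend hz, ?_⟩
  simp only [extChartAt, mfld_simps]
  exact ((D.affine_contDiff ∞ u a).contDiffAt.congr_of_eventuallyEq hu).contDiffWithinAt

lemma exists_mfderiv_projExtend_eq_scale {z : InfinitePlace K → ℂ} (hz : z ∈ D.domain) :
    ∃ u ∈ D.U, mfderiv 𝓘(ℝ, InfinitePlace K → ℂ) 𝓘(ℝ, InfinitePlace K → ℂ) D.projExtend z =
      D.scale u := by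
  obtain ⟨u, hu, a, heq⟩ := D.exists_chartAt_comp_projExtend_eventuallyEq hz
  refine ⟨u, hu, HasMFDerivAt.mfderiv ⟨D.continuousAt_projExtend hz, ?_⟩⟩
  simp only [writtenInExtChartAt, extChartAt, mfld_simps]
  exact ((D.hasFDerivAt_affine u a z).congr_of_eventuallyEq heq).hasFDerivWithinAt

lemma pullback_projExtend_pos {Ω : DForm (InfinitePlace K → ℂ) D.Manifold 2}
    (hΩ : Ω.IsTaming) {z v : InfinitePlace K → ℂ} (hz : z ∈ D.domain) (hv : v ≠ 0) :
    0 < Ω.pullback D.projExtend z ![v, Complex.I • v] := by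
  obtain ⟨u, -, hu⟩ := D.exists_mfderiv_projExtend_eq_scale hz
  have hscale : D.scale u ∘ ![v, Complex.I • v] = ![D.scale u v, Complex.I • D.scale u v] := by
    rw [← D.scale_smul]; ext i; fin_cases i <;> rfl
  have hpullback : Ω.pullback D.projExtend z ![v, Complex.I • v] =
      Ω (D.projExtend z) ![D.scale u v, tangentJ _ (D.scale u v)] := by
    rw [DForm.pullback, hu]
    exact congrArg (Ω (D.projExtend z)) hscale
  rw [hpullback]
  exact hΩ _ _ (D.scale_ne_zero u hv)

variable {k : ℕ} {α : DForm (InfinitePlace K → ℂ) D.Manifold k}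

lemma contDiffOn_pullback_projExtend (hα : α.IsSmooth) :
    ContDiffOn ℝ ∞ (α.pullback D.projExtend) D.domain := by
  intro z hz
  set c := chartAt (InfinitePlace K → ℂ) (D.projExtend z)
  obtain ⟨u, -, a, heq⟩ := D.exists_chartAt_comp_projExtend_eventuallyEq hz
  have hpullback : α.pullback D.projExtend =ᶠ[𝓝 z] fun y =>
      (α.inChart (D.projExtend z) (D.affine u a y)).compContinuousLinearMap (D.scale u) := by
    filter_upwards [α.pullback_eventuallyEq (D.contMDiffAt_projExtend hz),
      heq.eventuallyEq_nhds] with y hy hy_eq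
    rw [hy, hy_eq.fderiv_eq, (D.hasFDerivAt_affine u a y).fderiv, ← hy_eq.eq_of_nhds]
    rfl
  have hchart : ContDiffAt ℝ ∞ (α.inChart (D.projExtend z)) (D.affine u a z) := by
    rw [← heq.eq_of_nhds]
    exact (hα _).contDiffAt (c.open_target.mem_nhds (mem_chart_target _ _))
  refine (ContDiffAt.congr_of_eventuallyEq ?_ hpullback).contDiffWithinAt
  exact (ContinuousAlternatingMap.compContinuousLinearMapCLM (ι := Fin k) (F := ℝ)
    (D.scale u)).contDiff.contDiffAt.comp z
      (hchart.comp z (D.affine_contDiff ∞ u a).contDiffAt)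

lemma pullback_projExtend_affine (α : DForm (InfinitePlace K → ℂ) D.Manifold k) {u : (𝓞 K)ˣ}
    (hu : u ∈ D.U) (a : 𝓞 K) {z : InfinitePlace K → ℂ} (hz : z ∈ D.domain) :
    (α.pullback D.projExtend (D.affine u a z)).compContinuousLinearMap (D.scale u) =
      α.pullback D.projExtend z := by
  have hcomp : D.projExtend ∘ D.affine u a =ᶠ[𝓝 z] D.projExtend := by
    filter_upwards [D.domain.isOpen.mem_nhds hz] with y hy using D.projExtend_affine hu a hy
  rw [← α.pullback_comp ((D.contMDiffAt_projExtend (D.affine_mem hu a hz)).mdifferentiableAt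
    (by simp)) (D.hasFDerivAt_affine u a z), α.pullback_congr hcomp]

end Projection

section Cocompactness

lemma σ_eq_embedding_of_isReal {w : InfinitePlace K} (hw : w.IsReal) : D.σ w = w.embedding := by
  have hσ : ComplexEmbedding.IsReal (D.σ w) := by
    rwa [← InfinitePlace.isReal_mk_iff, D.mk_σ]
  rw [← InfinitePlace.embedding_mk_eq_of_isReal hσ, D.mk_σ]

lemma exists_linearIsometryEquiv_σ_eq_embedding (w : InfinitePlace K) :
    ∃ e : ℂ ≃ₗᵢ[ℝ] ℂ, ∀ x : K, e (D.σ w x) = w.embedding x := by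
  rcases InfinitePlace.embedding_mk_eq (D.σ w) with h | h <;> rw [D.mk_σ] at h
  · exact ⟨LinearIsometryEquiv.refl ℝ ℂ, fun x => by simp [h]⟩
  · exact ⟨Complex.conjLIE, fun x => by simp [h]⟩

lemma embedding_mem_horizontal (a : 𝓞 K) : D.embedding a ∈ horizontal K := fun _ hw =>
  D.σ_im hw a

lemma add_mem_domain {z x : InfinitePlace K → ℂ} (hz : z ∈ D.domain) (hx : x ∈ horizontal K) :
    z + x ∈ D.domain := fun w hw => by
  simpa [hx w hw] using hz w hw

lemma exists_norm_sub_embedding_le :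
    ∃ R : ℝ, ∀ x ∈ horizontal K, ∃ a : 𝓞 K, ‖x - D.embedding a‖ ≤ R := by
  classical
  obtain ⟨R, hR⟩ := exists_norm_sub_mixedEmbedding_le K
  choose e he using D.exists_linearIsometryEquiv_σ_eq_embedding
  refine ⟨R, fun x hx => ?_⟩
  let m : mixedEmbedding.mixedSpace K := (fun w => (x w).re, fun w => e w (x w))
  obtain ⟨a, ha⟩ := hR m
  refine ⟨a, (pi_norm_le_iff_of_nonneg ((norm_nonneg _).trans ha)).mpr fun w => ?_⟩
  refine le_trans ?_ ha
  rcases w.isReal_or_isComplex with hw | hw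
  · refine le_of_eq_of_le ?_ ((norm_le_pi_norm _ ⟨w, hw⟩).trans (norm_fst_le _))
    rw [← Complex.norm_real]
    have hx_re : ((x w).re : ℂ) = x w := Complex.ext rfl (hx w hw).symm
    simp [m, hx_re, InfinitePlace.embedding_of_isReal_apply, D.σ_eq_embedding_of_isReal hw]
  · refine le_of_eq_of_le ?_ ((norm_le_pi_norm _ ⟨w, hw⟩).trans (norm_snd_le _))
    simp [m, ← he, ← map_sub]

/-- A function on `ℍ ^ s × ℂ ^ t`, given on the ambient space, is periodic if it is invariant
under the translations in `𝓞 K`. -/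
def IsPeriodic {X : Type*} (Φ : (InfinitePlace K → ℂ) → X) : Prop :=
  ∀ a : 𝓞 K, ∀ z ∈ D.domain, Φ (z + D.embedding a) = Φ z

variable {D} in
lemma IsPeriodic.isCompact_image {X : Type*} [TopologicalSpace X]
    {Φ : (InfinitePlace K → ℂ) → X} (hper : D.IsPeriodic Φ) (hΦ : ContinuousOn Φ D.domain)
    {z : InfinitePlace K → ℂ} (hz : z ∈ D.domain) :
    IsCompact ((fun x => Φ (z + x)) '' horizontal K) := by
  obtain ⟨R, hR⟩ := D.exists_norm_sub_embedding_le
  have himage : (fun x => Φ (z + x)) '' horizontal K =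
      (fun x => Φ (z + x)) '' (horizontal K ∩ Metric.closedBall 0 R) := by
    refine (Set.image_subset_iff.mpr fun x hx => ?_).antisymm
      (Set.image_mono Set.inter_subset_left)
    obtain ⟨a, ha⟩ := hR x hx
    have hxa := sub_mem hx (D.embedding_mem_horizontal a)
    refine ⟨x - D.embedding a, ⟨hxa, mem_closedBall_zero_iff.mpr ha⟩, ?_⟩
    simpa [add_assoc] using (hper a _ (D.add_mem_domain hz hxa)).symm
  rw [himage]
  refine ((isCompact_closedBall 0 R).inter_left
    (horizontal K).closed_of_finiteDimensional).image_of_continuousOn ?_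
  exact hΦ.comp (by fun_prop) fun x hx => D.add_mem_domain hz hx.1

end Cocompactness

section Stokes

lemma isPeriodic_extDeriv {k : ℕ}
    {β : (InfinitePlace K → ℂ) → (InfinitePlace K → ℂ) [⋀^Fin k]→L[ℝ] ℝ}
    (hβ : D.IsPeriodic β) : D.IsPeriodic (extDeriv β) := by
  intro a z hz
  have hnear : (fun y => β (y + D.embedding a)) =ᶠ[𝓝 z] β := by
    filter_upwards [D.domain.isOpen.mem_nhds hz] with y hy using hβ a y hy
  rw [← hnear.extDeriv_eq, extDeriv, extDeriv, fderiv_comp_add_right]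

lemma exists_extDeriv_nonpos_of_isPeriodic
    {β : (InfinitePlace K → ℂ) → (InfinitePlace K → ℂ) [⋀^Fin 1]→L[ℝ] ℝ}
    (hper : D.IsPeriodic β) (hβ : ContDiffOn ℝ 1 β D.domain) {v w : InfinitePlace K → ℂ}
    (hv : v ∈ horizontal K) (hw : w ∈ horizontal K) :
    ∃ z ∈ D.domain, extDeriv β z ![v, w] ≤ 0 := by
  obtain ⟨z₀, hz₀⟩ := D.domain_nonempty
  have hcont : ContinuousOn (fun z => extDeriv β z ![v, w]) D.domain :=
    (ContinuousAlternatingMap.apply ℝ _ ℝ ![v, w]).continuous.comp_continuousOn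
      (continuousOn_extDeriv D.domain.isOpen hβ)
  have hper_apply : D.IsPeriodic fun z => extDeriv β z ![v, w] := fun a z hz =>
    congrArg (· ![v, w]) (D.isPeriodic_extDeriv hper a z hz)
  obtain ⟨_, ⟨x, hx, rfl⟩, hmin⟩ := (hper_apply.isCompact_image hcont hz₀).exists_isLeast
    ((horizontal K).nonempty.image _)
  obtain ⟨B, hB⟩ := (hper.isCompact_image hβ.continuousOn hz₀).isBounded.exists_norm_le
  refine ⟨z₀ + x, D.add_mem_domain hz₀ hx, ?_⟩
  by_contra! hpos
  have hplane (p : ℝ × ℝ) : p.1 • v + p.2 • w ∈ horizontal K :=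
    add_mem (Submodule.smul_mem _ _ hv) (Submodule.smul_mem _ _ hw)
  obtain ⟨p, hp⟩ := exists_extDeriv_lt_of_bounded_on_plane D.domain.isOpen hβ
    (fun p => D.add_mem_domain hz₀ (hplane p))
    (fun p => hB _ (Set.mem_image_of_mem _ (hplane p))) hpos
  exact hp.not_ge (hmin (Set.mem_image_of_mem _ (hplane p)))

end Stokes

section LeeForm

lemma exists_mem_U_ne_one : ∃ u ∈ D.U, u ≠ 1 := by
  classical
  by_contra! htrivial
  have : Nonempty {w : InfinitePlace K // w.IsReal} := Fintype.card_pos_iff.mp D.real_pos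
  refine bot_ne_top ((Submodule.span_eq_bot.mpr ?_).symm.trans D.span_eq_top)
  rintro _ ⟨u, hu, rfl⟩
  ext
  simp [htrivial u hu]

lemma isPeriodic_of_affine_eq_add_const {f : (InfinitePlace K → ℂ) → ℝ}
    (hf : ∀ u ∈ D.U, ∀ a, ∃ c, ∀ z ∈ D.domain, f (D.affine u a z) = f z + c) :
    D.IsPeriodic f := by
  obtain ⟨z₀, hz₀⟩ := D.domain_nonempty
  have htranslate (a : 𝓞 K) : ∃ c, ∀ z ∈ D.domain, f (z + D.embedding a) = f z + c := by
    simpa [affine_eq, scale_one] using hf 1 D.U.one_mem a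
  choose c hc using htranslate
  have hc_add (a b : 𝓞 K) : c (a + b) = c a + c b := by
    have := hc (a + b) z₀ hz₀
    rw [map_add, ← add_assoc, hc _ _ (D.add_embedding_mem_domain a hz₀), hc _ _ hz₀] at this
    linarith
  obtain ⟨u, hu, hu_ne⟩ := D.exists_mem_U_ne_one
  have hc_mul (a : 𝓞 K) : c (u * a) = c a := by
    obtain ⟨c', hc'⟩ := hf u hu 0
    simp only [affine_eq, map_zero, add_zero] at hc'
    have hscale_mem : D.scale u z₀ ∈ D.domain := by
      simpa [affine_eq] using D.affine_mem hu 0 hz₀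
    have := hc' _ (D.add_embedding_mem_domain a hz₀)
    rw [map_add, scale_embedding, hc _ _ hscale_mem, hc' _ hz₀, hc _ _ hz₀] at this
    linarith
  have hc_zero := addMonoidHom_eq_zero_of_map_mul_left (u := (u : 𝓞 K)) (by simpa using hu_ne)
    (AddMonoidHom.mk' c hc_add) hc_mul
  intro a z hz
  rw [hc a z hz, show c a = 0 from DFunLike.congr_fun hc_zero a, add_zero]

variable {θ : DForm (InfinitePlace K → ℂ) D.Manifold 1}

lemma exists_isPeriodic_primitive (hθ : θ.IsClosedForm) :
    ∃ f : (InfinitePlace K → ℂ) → ℝ, D.IsPeriodic f ∧ ContDiffOn ℝ ∞ f D.domain ∧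
      ∀ z ∈ D.domain, HasFDerivAt f (oneFormEquiv _ (θ.pullback D.projExtend z)) z := by
  have hsmooth := D.contDiffOn_pullback_projExtend hθ.1
  have hclosed : ∀ z ∈ D.domain, extDeriv (θ.pullback D.projExtend) z = 0 := fun z hz => by
    rw [← DForm.pullback_d hθ.1 (D.contMDiffAt_projExtend hz), hθ.2]
    rfl
  obtain ⟨f, hf⟩ := exists_primitive_of_extDeriv_eq_zero D.convex_domain D.domain.isOpen
    (hsmooth.differentiableOn (by simp)) hclosed
  refine ⟨f, ?_, ?_, hf⟩
  · refine D.isPeriodic_of_affine_eq_add_const fun u hu a => ?_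
    refine exists_comp_eq_add_const D.domain.isOpen D.convex_domain.isPreconnected hf
      (fun z _ => D.hasFDerivAt_affine u a z) (fun z hz => D.affine_mem hu a hz) fun z hz => ?_
    rw [← oneFormEquiv_compContinuousLinearMap, D.pullback_projExtend_affine θ hu a hz]
  · refine (contDiffOn_infty_iff_fderiv_of_isOpen D.domain.isOpen).mpr ⟨fun z hz => ?_, ?_⟩
    · exact (hf z hz).differentiableAt.differentiableWithinAt
    · exact ((oneFormEquiv (InfinitePlace K → ℂ)).contDiff.comp_contDiffOn hsmooth).congr
        fun z hz => (hf z hz).fderiv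

lemma isPeriodic_pullback_projExtend {k : ℕ} (α : DForm (InfinitePlace K → ℂ) D.Manifold k) :
    D.IsPeriodic (α.pullback D.projExtend) := fun a z hz => by
  have h := D.pullback_projExtend_affine α D.U.one_mem a hz
  rw [scale_one, affine_eq, scale_one] at h
  exact h

lemma exists_pullback_dTwisted_nonpos (hθ : θ.IsClosedForm)
    {η : DForm (InfinitePlace K → ℂ) D.Manifold 1} (hη : η.IsSmooth)
    {v w : InfinitePlace K → ℂ} (hv : v ∈ horizontal K) (hw : w ∈ horizontal K) :
    ∃ z ∈ D.domain, (DForm.dTwisted θ η).pullback D.projExtend z ![v, w] ≤ 0 := by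
  obtain ⟨f, hf_per, hf_contDiff, hf⟩ := D.exists_isPeriodic_primitive hθ
  have hη_contDiff := D.contDiffOn_pullback_projExtend hη
  have hper : D.IsPeriodic fun z => Real.exp (-f z) • η.pullback D.projExtend z := fun a z hz => by
    simp only [hf_per a z hz, D.isPeriodic_pullback_projExtend η a z hz]
  obtain ⟨z, hz, hnonpos⟩ := D.exists_extDeriv_nonpos_of_isPeriodic hper
    ((hf_contDiff.neg.exp.smul hη_contDiff).of_le (by simp)) hv hw
  refine ⟨z, hz, ?_⟩
  have hη_diff := (hη_contDiff.contDiffAt (D.domain.isOpen.mem_nhds hz)).differentiableAt (by simp)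
  rw [DForm.extDeriv_exp_neg_smul_pullback hη (D.contMDiffAt_projExtend hz) hη_diff (hf z hz)]
    at hnonpos
  exact nonpos_of_mul_nonpos_right hnonpos (Real.exp_pos _)

end LeeForm

end OTData

end

theorem mainTheorem10_general {K : Type*} [Field K] [NumberField K] (D : OTData K)
    {θ : DForm (NumberField.InfinitePlace K → ℂ) D.Manifold 1} (hθ : θ.IsClosedForm)
    {Ω : DForm (NumberField.InfinitePlace K → ℂ) D.Manifold 2} (hΩ : Ω.IsTaming) :
    ¬ DForm.IsTwistedExact θ Ω := by
  classical
  rintro ⟨η, hη, rfl⟩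
  obtain ⟨w, hw⟩ := Fintype.card_pos_iff.mp D.complex_pos
  obtain ⟨z, hz, hnonpos⟩ :=
    D.exists_pullback_dTwisted_nonpos hθ hη (OTData.single_mem_horizontal hw 1)
      (OTData.single_mem_horizontal hw Complex.I)
  refine hnonpos.not_gt ?_
  have hI : Pi.single w Complex.I = Complex.I • (Pi.single w 1 : _ → ℂ) := by
    rw [← Pi.single_smul, smul_eq_mul, mul_one]
  rw [hI]
  exact D.pullback_projExtend_pos hΩ hz (by simp)

theorem mainTheorem10 {K : Type*} [Field K] [NumberField K] (D : OTData K)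
    (θ : DForm (NumberField.InfinitePlace K → ℂ) D.Manifold 1) (hθ : θ.IsClosedForm) :
    ¬ ∃ Ω : DForm (NumberField.InfinitePlace K → ℂ) D.Manifold 2,
      Ω.IsLCK ∧ DForm.IsTwistedExact θ Ω := by
  rintro ⟨Ω, ⟨-, ⟨g, -, hg⟩, -⟩, hexact⟩
  exact mainTheorem10_general D hθ hg.isTaming hexact
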